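/- Let $F:[0,\infty)\to[0,\infty)$ be a non-decreasing sparseness measure, that is, a non-decreasing function such that $F(|x+y|)\le F(|x|)+F(|y|)$ for all $x,y\in\mathbb{R}$, and $F(x)=0$ if and only if $x=0$. For $z\in\mathbb{R}^n$ and $T\subseteq\{1,\dots,n\}$ put $J(z_T)=\sum_{i\in T}F(|z_i|)$. Let $G_l(\mathbb{R}^n)$ be the Grassmann manifold of $l$-dimensional linear subspaces of $\mathbb{R}^n$, with the metric $\operatorname{dist}(\nu,\nu')=\|P_\nu-P_{\nu'}\|$ (spectral norm of the difference of the orthogonal projections) and with the smooth structure given by the standard charts $(U_I,\varphi_I)$: here $I\subseteq\{1,\dots,n\}$, $|I|=l$, $U_I$ is the set of column spaces of the $n\times l$ matrices $Y$ whose submatrix $Y_I$ of rows indexed by $I$ is invertible, and $\varphi_I$ sends the column space of such a $Y$ to the rows of $YY_I^{-1}$ indexed by the complement of $I$, an $(n-l)\times l$ matrix. For $k\ge 0$ let $$\Omega_J=\{\nu\in G_l(\mathbb{R}^n) : J(z_T)<J(z_{T^c})\ \text{ for all } z\in\nu\setminus\{0\} \text{ and all } T\subseteq\{1,\dots,n\}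 \text{ with } |T|\le k\}.$$ Then the set $\overline{\Omega}_J\setminus\operatorname{int}(\Omega_J)$ has measure zero in $G_l(\mathbb{R}^n)$, i.e. $\varphi\big((\overline{\Omega}_J\setminus\operatorname{int}(\Omega_J))\cap U\big)$ has Lebesgue measure zero for every chart $(U,\varphi)$ of the smooth structure, and it is of the first category (a countable union of nowhere dense sets) in $G_l(\mathbb{R}^n)$. -/

import Mathlib

open MeasureTheory
open scoped NNReal Matrix Manifold ContDiff

namespace SparseRecovery

/-! ### Sparseness measures and cost functions -/

/-- A sparseness measure is a function `F : [0, ∞) → [0, ∞)` such that `F(|·|)` is subadditive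
on `ℝ` and `F` vanishes exactly at `0`. -/
structure IsSparsenessMeasure (F : ℝ≥0 → ℝ≥0) : Prop where
  subadd : ∀ x y : ℝ, F (Real.nnabs (x + y)) ≤ F (Real.nnabs x) + F (Real.nnabs y)
  eq_zero_iff : ∀ x : ℝ≥0, F x = 0 ↔ x = 0

/-- The partial cost `J(z_T) = ∑_{i ∈ T} F(|z_i|)`. -/
noncomputable def cost {n : ℕ} (F : ℝ≥0 → ℝ≥0) (T : Finset (Fin n))
    (z : EuclideanSpace ℝ (Fin n)) : ℝ≥0 :=
  ∑ i ∈ T, F (Real.nnabs (z i))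

/-! ### The Grassmannian as a metric space -/

/-- The Grassmannian `G_l(ℝⁿ)` of `l`-dimensional linear subspaces of `ℝⁿ`. -/
@[ext]
structure Grassmannian (n l : ℕ) where
  /-- The underlying linear subspace. -/
  toSubmodule : Submodule ℝ (EuclideanSpace ℝ (Fin n))
  finrank_eq : Module.finrank ℝ toSubmodule = l

namespace Grassmannian

variable {n l : ℕ}

theorem starProjection_injective :
    Function.Injective fun ν : Grassmannian n l => ν.toSubmodule.starProjection := by
  intro ν ν' h
  apply Grassmannian.ext
  have h' : ν.toSubmodule.starProjection = ν'.toSubmodule.starProjection := h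
  rw [← Submodule.range_starProjection ν.toSubmodule, ← Submodule.range_starProjection ν'.toSubmodule, h']

/-- The metric `dist ν ν' = ‖P_ν - P_ν'‖`, where `P_ν` is the orthogonal projection onto `ν` and
`‖·‖` is the operator (spectral) norm. -/
noncomputable instance : MetricSpace (Grassmannian n l) :=
  MetricSpace.induced (fun ν => ν.toSubmodule.starProjection) starProjection_injective inferInstance

theorem dist_eq (ν ν' : Grassmannian n l) :
    dist ν ν' = ‖ν.toSubmodule.starProjection - ν'.toSubmodule.starProjection‖ :=
  dist_eq_norm ν.toSubmodule.starProjection ν'.toSubmodule.starProjection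

/-! ### Charts -/

/-- The index sets `I = {i₁ < ⋯ < i_l} ⊆ {1, …, n}`. -/
structure IndexSet (n l : ℕ) where
  /-- The underlying finite set. -/
  toFinset : Finset (Fin n)
  card_eq : toFinset.card = l

theorem IndexSet.card_compl (I : IndexSet n l) : (I.toFinsetᶜ).card = n - l := by
  rw [Finset.card_compl, Fintype.card_fin, I.card_eq]

/-- The increasing enumeration of `I`. -/
def IndexSet.row (I : IndexSet n l) : Fin l ↪o Fin n := I.toFinset.orderEmbOfFin I.card_eq

/-- The increasing enumeration of the complement of `I`. -/
def IndexSet.coRow (I : IndexSet n l) : Fin (n - l) ↪o Fin n :=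
  I.toFinsetᶜ.orderEmbOfFin I.card_compl

/-- The column space of an `n × l` matrix. -/
def colSpan (Y : Matrix (Fin n) (Fin l) ℝ) : Submodule ℝ (EuclideanSpace ℝ (Fin n)) :=
  Submodule.span ℝ (Set.range fun j : Fin l => WithLp.toLp 2 (Y.col j))

/-- The chart domain `U_I`: the subspaces which are the column space of a matrix `Y` whose rows
indexed by `I` form an invertible matrix `Y_I`. -/
def chartDomain (I : IndexSet n l) : Set (Grassmannian n l) :=
  {ν | ∃ Y : Matrix (Fin n) (Fin l) ℝ, colSpan Y = ν.toSubmodule ∧ (Y.submatrix I.row id).det ≠ 0}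

/-- The space `𝕄(n-l, l)` of `(n-l) × l` real matrices, in which the charts take their values. -/
abbrev Model (n l : ℕ) : Type := Fin (n - l) → Fin l → ℝ

/-- The rows indexed by the complement of `I` of the matrix `Y Y_I⁻¹`. -/
noncomputable def normalForm (I : IndexSet n l) (Y : Matrix (Fin n) (Fin l) ℝ) : Model n l :=
  (Y * (Y.submatrix I.row id)⁻¹).submatrix I.coRow id

open Classical in
/-- The coordinate map `φ_I : U_I → 𝕄(n-l, l)`, `ν ↦ (Y Y_I⁻¹)_{Iᶜ}` where `Y` is any matrix with
column space `ν` (extended by `0` outside `U_I`). -/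
noncomputable def coord (I : IndexSet n l) (ν : Grassmannian n l) : Model n l :=
  if h : ν ∈ chartDomain I then normalForm I h.choose else 0

/-- The `n × l` matrix `X` with `X_I = 1` and `X_{Iᶜ} = M`. -/
noncomputable def stack (I : IndexSet n l) (M : Model n l) : Matrix (Fin n) (Fin l) ℝ :=
  fun i j =>
    if h : i ∈ I.toFinset then
      (1 : Matrix (Fin l) (Fin l) ℝ) ((I.toFinset.orderIsoOfFin I.card_eq).symm ⟨i, h⟩) j
    else M ((I.toFinsetᶜ.orderIsoOfFin I.card_compl).symm ⟨i, Finset.mem_compl.2 h⟩) j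

/-! ### The charts are homeomorphisms onto `𝕄(n-l, l)` -/

theorem mem_colSpan {Y : Matrix (Fin n) (Fin l) ℝ} {x : EuclideanSpace ℝ (Fin n)} :
    x ∈ colSpan Y ↔ ∃ c : Fin l → ℝ, WithLp.toLp 2 (Y *ᵥ c) = x := by
  rw [colSpan, Submodule.mem_span_range_iff_exists_fun]
  refine exists_congr fun c => ?_
  have : ∑ i, c i • (WithLp.toLp 2 (Y.col i) : EuclideanSpace ℝ (Fin n))
      = WithLp.toLp 2 (Y *ᵥ c) := by
    ext a
    simp [Matrix.mulVec, dotProduct, mul_comm]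
  rw [this]

theorem row_mem (I : IndexSet n l) (a : Fin l) : I.row a ∈ I.toFinset :=
  Finset.orderEmbOfFin_mem _ _ _

theorem coRow_notMem (I : IndexSet n l) (a : Fin (n - l)) : I.coRow a ∉ I.toFinset :=
  Finset.mem_compl.1 (Finset.orderEmbOfFin_mem _ I.card_compl a)

theorem stack_row (I : IndexSet n l) (M : Model n l) : (stack I M).submatrix I.row id = 1 := by
  ext a j
  have : (I.toFinset.orderIsoOfFin I.card_eq).symm ⟨I.row a, row_mem I a⟩ = a := by
    rw [OrderIso.symm_apply_eq]
    rfl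
  simp only [stack, Matrix.submatrix_apply, row_mem, dif_pos, id]
  exact congrFun (congrArg _ this) j

theorem stack_coRow (I : IndexSet n l) (M : Model n l) :
    (stack I M).submatrix I.coRow id = M := by
  ext a j
  have : (⟨I.coRow a, Finset.mem_compl.2 (coRow_notMem I a)⟩ : (I.toFinsetᶜ : Finset (Fin n)))
      = I.toFinsetᶜ.orderIsoOfFin I.card_compl a := rfl
  simp only [stack, Matrix.submatrix_apply, coRow_notMem, not_false_eq_true, dif_neg, this,
    OrderIso.symm_apply_apply, id]

theorem matrix_ext_rows (I : IndexSet n l) {X Y : Matrix (Fin n) (Fin l) ℝ}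
    (h₁ : X.submatrix I.row id = Y.submatrix I.row id)
    (h₂ : X.submatrix I.coRow id = Y.submatrix I.coRow id) : X = Y := by
  ext i j
  by_cases hi : i ∈ I.toFinset
  · obtain ⟨a, ha⟩ : i ∈ Set.range I.row := by
      rw [IndexSet.row, Finset.range_orderEmbOfFin]; exact hi
    subst ha
    exact congrFun (congrFun h₁ a) j
  · obtain ⟨a, ha⟩ : i ∈ Set.range I.coRow := by
      rw [IndexSet.coRow, Finset.range_orderEmbOfFin]; simpa using hi
    subst ha
    exact congrFun (congrFun h₂ a) j

theorem mulVec_injective_of_det {I : IndexSet n l} {Y : Matrix (Fin n) (Fin l) ℝ}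
    (h : (Y.submatrix I.row id).det ≠ 0) : Function.Injective Y.mulVec := by
  intro c d hcd
  apply Matrix.mulVec_injective_of_det_ne_zero h
  funext a
  exact congrFun hcd (I.row a)

theorem finrank_colSpan {Y : Matrix (Fin n) (Fin l) ℝ} (h : Function.Injective Y.mulVec) :
    Module.finrank ℝ (colSpan Y) = l := by
  have hli : LinearIndependent ℝ fun j : Fin l =>
      (WithLp.toLp 2 (Y.col j) : EuclideanSpace ℝ (Fin n)) := by
    have h1 : LinearIndependent ℝ Y.col := Matrix.mulVec_injective_iff.1 h
    exact h1.map' (WithLp.linearEquiv 2 ℝ (Fin n → ℝ)).symm.toLinearMap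
      (LinearMap.ker_eq_bot.2 (LinearEquiv.injective _))
  rw [colSpan, finrank_span_eq_card hli, Fintype.card_fin]

theorem exists_colSpan (ν : Grassmannian n l) :
    ∃ Y : Matrix (Fin n) (Fin l) ℝ, colSpan Y = ν.toSubmodule ∧ Function.Injective Y.mulVec := by
  let b := Module.finBasisOfFinrankEq ℝ ν.toSubmodule ν.finrank_eq
  have hspan : Submodule.span ℝ (Set.range fun j => (b j : EuclideanSpace ℝ (Fin n))) = ν.toSubmodule := by
    have : (Set.range fun j => (b j : EuclideanSpace ℝ (Fin n))) = ν.toSubmodule.subtype '' Set.range b := by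
      rw [← Set.range_comp]; rfl
    rw [this, Submodule.span_image, b.span_eq, Submodule.map_top, Submodule.range_subtype]
  refine ⟨Matrix.of fun i j => (b j : EuclideanSpace ℝ (Fin n)) i, hspan, ?_⟩
  rw [Matrix.mulVec_injective_iff]
  have h1 : LinearIndependent ℝ fun j => (b j : EuclideanSpace ℝ (Fin n)) :=
    b.linearIndependent.map' ν.toSubmodule.subtype (Submodule.ker_subtype _)
  exact h1.map' (WithLp.linearEquiv 2 ℝ (Fin n → ℝ)).toLinearMap
      (LinearMap.ker_eq_bot.2 (LinearEquiv.injective _))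

theorem isUnit_gram {Y : Matrix (Fin n) (Fin l) ℝ} (h : Function.Injective Y.mulVec) :
    IsUnit (Yᵀ * Y).det := by
  rw [← Matrix.isUnit_iff_isUnit_det, ← Matrix.mulVec_injective_iff_isUnit]
  have : LinearMap.ker (Yᵀ * Y).mulVecLin = ⊥ := by
    rw [Matrix.ker_mulVecLin_transpose_mul_self]
    exact LinearMap.ker_eq_bot.2 h
  exact LinearMap.ker_eq_bot.1 this

/-- The projection onto the column space of `Y` is `Y (Yᵀ Y)⁻¹ Yᵀ`. -/
theorem starProjection_colSpan {Y : Matrix (Fin n) (Fin l) ℝ} (h : Function.Injective Y.mulVec) :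
    (colSpan Y).starProjection
      = Matrix.toEuclideanCLM (n := Fin n) (𝕜 := ℝ) (Y * (Yᵀ * Y)⁻¹ * Yᵀ) := by
  ext1 x
  apply Submodule.eq_starProjection_of_mem_of_inner_eq_zero
  · rw [mem_colSpan]
    refine ⟨((Yᵀ * Y)⁻¹ * Yᵀ) *ᵥ x.ofLp, ?_⟩
    rw [Matrix.mulVec_mulVec, ← Matrix.mul_assoc]
    rfl
  · intro w hw
    obtain ⟨c, rfl⟩ := mem_colSpan.1 hw
    have key : Yᵀ *ᵥ (x.ofLp - (Y * (Yᵀ * Y)⁻¹ * Yᵀ) *ᵥ x.ofLp) = 0 := by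
      rw [Matrix.mulVec_sub, Matrix.mulVec_mulVec, ← Matrix.mul_assoc, ← Matrix.mul_assoc,
        Matrix.mul_nonsing_inv _ (isUnit_gram h), Matrix.one_mul, sub_self]
    rw [EuclideanSpace.inner_eq_star_dotProduct]
    simp only [star_trivial, WithLp.ofLp_sub, Matrix.ofLp_toEuclideanCLM]
    rw [dotProduct_comm, Matrix.dotProduct_mulVec, ← Matrix.mulVec_transpose, key,
      zero_dotProduct]

/-- The matrix of the orthogonal projection onto `ν`. -/
noncomputable def projMatrix (ν : Grassmannian n l) : Matrix (Fin n) (Fin n) ℝ :=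
  (Matrix.toEuclideanCLM (n := Fin n) (𝕜 := ℝ)).symm ν.toSubmodule.starProjection

theorem continuous_projMatrix : Continuous (projMatrix : Grassmannian n l → _) := by
  have h1 : Continuous fun ν : Grassmannian n l => ν.toSubmodule.starProjection :=
    continuous_induced_dom
  have h2 : Continuous (Matrix.toEuclideanCLM (n := Fin n) (𝕜 := ℝ)).symm :=
    LinearMap.continuous_of_finiteDimensional
      ((Matrix.toEuclideanCLM (n := Fin n) (𝕜 := ℝ)).symm.toAlgEquiv.toLinearMap)
  exact h2.comp h1

theorem projMatrix_eq {ν : Grassmannian n l} {Y : Matrix (Fin n) (Fin l) ℝ}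
    (hY : colSpan Y = ν.toSubmodule) (h : Function.Injective Y.mulVec) :
    projMatrix ν = Y * (Yᵀ * Y)⁻¹ * Yᵀ := by
  obtain ⟨ν, hν⟩ := ν
  change colSpan Y = ν at hY
  subst hY
  rw [projMatrix, starProjection_colSpan h, StarAlgEquiv.symm_apply_apply]

/-- The columns indexed by `I` of the projection matrix. -/
noncomputable def projCols (I : IndexSet n l) (ν : Grassmannian n l) :
    Matrix (Fin n) (Fin l) ℝ :=
  (projMatrix ν).submatrix id I.row

theorem projCols_eq (I : IndexSet n l) {ν : Grassmannian n l} {Y : Matrix (Fin n) (Fin l) ℝ}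
    (hY : colSpan Y = ν.toSubmodule) (h : Function.Injective Y.mulVec) :
    projCols I ν = Y * ((Yᵀ * Y)⁻¹ * (Y.submatrix I.row id)ᵀ) := by
  rw [projCols, projMatrix_eq hY h, Matrix.mul_assoc]
  rfl

theorem projCols_row_eq (I : IndexSet n l) {ν : Grassmannian n l}
    {Y : Matrix (Fin n) (Fin l) ℝ} (hY : colSpan Y = ν.toSubmodule) (h : Function.Injective Y.mulVec) :
    (projCols I ν).submatrix I.row id
      = Y.submatrix I.row id * ((Yᵀ * Y)⁻¹ * (Y.submatrix I.row id)ᵀ) := by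
  rw [projCols_eq I hY h]
  rfl

theorem mem_chartDomain_iff (I : IndexSet n l) (ν : Grassmannian n l) :
    ν ∈ chartDomain I ↔ ((projCols I ν).submatrix I.row id).det ≠ 0 := by
  constructor
  · rintro ⟨Y, hY, hdet⟩
    have h := mulVec_injective_of_det hdet
    rw [projCols_row_eq I hY h, Matrix.det_mul, Matrix.det_mul, Matrix.det_transpose]
    have h2 : ((Yᵀ * Y)⁻¹).det ≠ 0 :=
      ((Matrix.isUnit_nonsing_inv_det_iff).2 (isUnit_gram h)).ne_zero
    exact mul_ne_zero hdet (mul_ne_zero h2 hdet)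
  · intro hdet
    obtain ⟨Y, hY, h⟩ := exists_colSpan ν
    rw [projCols_row_eq I hY h, Matrix.det_mul] at hdet
    exact ⟨Y, hY, left_ne_zero_of_mul hdet⟩

theorem det_ne_zero_of_mem {I : IndexSet n l} {ν : Grassmannian n l}
    (hν : ν ∈ chartDomain I) {Y : Matrix (Fin n) (Fin l) ℝ} (hY : colSpan Y = ν.toSubmodule)
    (h : Function.Injective Y.mulVec) : (Y.submatrix I.row id).det ≠ 0 := by
  rw [mem_chartDomain_iff, projCols_row_eq I hY h, Matrix.det_mul] at hν
  exact left_ne_zero_of_mul hν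

/-- `Y Y_I⁻¹` is unchanged when `Y` is multiplied on the right by an invertible matrix. -/
theorem normalForm_mul (I : IndexSet n l) (Y : Matrix (Fin n) (Fin l) ℝ)
    {V : Matrix (Fin l) (Fin l) ℝ} (hV : IsUnit V.det) :
    normalForm I (Y * V) = normalForm I Y := by
  have h1 : (Y * V).submatrix I.row id = Y.submatrix I.row id * V := rfl
  rw [normalForm, normalForm, h1, Matrix.mul_inv_rev, ← Matrix.mul_assoc, Matrix.mul_assoc Y V,
    Matrix.mul_nonsing_inv _ hV, Matrix.mul_one]

theorem normalForm_projCols (I : IndexSet n l) {ν : Grassmannian n l}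
    {Y : Matrix (Fin n) (Fin l) ℝ} (hY : colSpan Y = ν.toSubmodule)
    (hdet : (Y.submatrix I.row id).det ≠ 0) :
    normalForm I (projCols I ν) = normalForm I Y := by
  have h := mulVec_injective_of_det hdet
  rw [projCols_eq I hY h]
  apply normalForm_mul
  rw [Matrix.det_mul, Matrix.det_transpose]
  exact ((Matrix.isUnit_nonsing_inv_det_iff).2 (isUnit_gram h)).mul hdet.isUnit

/-- The coordinates do not depend on the choice of the matrix `Y`. -/
theorem coord_eq (I : IndexSet n l) {ν : Grassmannian n l} {Y : Matrix (Fin n) (Fin l) ℝ}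
    (hY : colSpan Y = ν.toSubmodule) (hdet : (Y.submatrix I.row id).det ≠ 0) :
    coord I ν = normalForm I Y := by
  have hν : ν ∈ chartDomain I := ⟨Y, hY, hdet⟩
  rw [coord, dif_pos hν, ← normalForm_projCols I hY hdet,
    ← normalForm_projCols I hν.choose_spec.1 hν.choose_spec.2]

theorem det_stack_row (I : IndexSet n l) (M : Model n l) :
    ((stack I M).submatrix I.row id).det ≠ 0 := by
  rw [stack_row, Matrix.det_one]
  exact one_ne_zero

/-- The inverse chart: `M` is sent to the column space of the matrix `X` with `X_I = 1` and
`X_{Iᶜ} = M`. -/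
noncomputable def coordInv (I : IndexSet n l) (M : Model n l) : Grassmannian n l :=
  ⟨colSpan (stack I M), finrank_colSpan (mulVec_injective_of_det (det_stack_row I M))⟩

theorem coordInv_mem (I : IndexSet n l) (M : Model n l) : coordInv I M ∈ chartDomain I :=
  ⟨stack I M, rfl, det_stack_row I M⟩

theorem coord_coordInv (I : IndexSet n l) (M : Model n l) : coord I (coordInv I M) = M := by
  rw [coord_eq (ν := coordInv I M) I rfl (det_stack_row I M), normalForm, stack_row, inv_one,
    Matrix.mul_one, stack_coRow]

theorem colSpan_mul (Y : Matrix (Fin n) (Fin l) ℝ) {V : Matrix (Fin l) (Fin l) ℝ}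
    (hV : IsUnit V.det) : colSpan (Y * V) = colSpan Y := by
  ext x
  rw [mem_colSpan, mem_colSpan]
  constructor
  · rintro ⟨c, rfl⟩
    exact ⟨V *ᵥ c, by rw [Matrix.mulVec_mulVec]⟩
  · rintro ⟨c, rfl⟩
    refine ⟨V⁻¹ *ᵥ c, ?_⟩
    rw [Matrix.mulVec_mulVec, Matrix.mul_assoc, Matrix.mul_nonsing_inv _ hV, Matrix.mul_one]

theorem coordInv_coord (I : IndexSet n l) {ν : Grassmannian n l} (hν : ν ∈ chartDomain I) :
    coordInv I (coord I ν) = ν := by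
  obtain ⟨Y, hY, hdet⟩ := hν
  have hstack : stack I (coord I ν) = Y * (Y.submatrix I.row id)⁻¹ := by
    apply matrix_ext_rows I
    · rw [stack_row]
      exact (Matrix.mul_nonsing_inv _ hdet.isUnit).symm
    · rw [stack_coRow, coord_eq I hY hdet]
      rfl
  apply Grassmannian.ext
  change colSpan (stack I (coord I ν)) = ν.toSubmodule
  rw [hstack, colSpan_mul _ ((Matrix.isUnit_nonsing_inv_det_iff).2 hdet.isUnit), hY]

theorem continuous_projCols (I : IndexSet n l) :
    Continuous (projCols I : Grassmannian n l → _) :=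
  continuous_projMatrix.matrix_submatrix _ _

theorem isOpen_chartDomain (I : IndexSet n l) : IsOpen (chartDomain I) := by
  have : chartDomain I = {ν | ((projCols I ν).submatrix I.row id).det ≠ 0} :=
    Set.ext fun ν => mem_chartDomain_iff I ν
  rw [this]
  exact isOpen_ne_fun ((continuous_projCols I).matrix_submatrix _ _).matrix_det continuous_const

/-- Matrix inversion is smooth, entry by entry, along smooth families of invertible matrices. -/
theorem contDiffOn_inv_apply {E : Type*} [NormedAddCommGroup E] [NormedSpace ℝ E] {s : Set E}
    {A : E → Matrix (Fin l) (Fin l) ℝ} (hA : ∀ i j, ContDiffOn ℝ ∞ (fun x => A x i j) s)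
    (hdet : ∀ x ∈ s, (A x).det ≠ 0) (i j : Fin l) :
    ContDiffOn ℝ ∞ (fun x => (A x)⁻¹ i j) s := by
  have hd : ∀ B : E → Matrix (Fin l) (Fin l) ℝ,
      (∀ i j, ContDiffOn ℝ ∞ (fun x => B x i j) s) → ContDiffOn ℝ ∞ (fun x => (B x).det) s := by
    intro B hB
    simp only [Matrix.det_apply]
    refine ContDiffOn.sum fun σ _ => ?_
    exact (contDiffOn_prod fun k _ => hB _ _).const_smul _
  have hadj : ContDiffOn ℝ ∞ (fun x => (A x).adjugate i j) s := by
    simp only [Matrix.adjugate_apply]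
    refine hd _ fun a b => ?_
    by_cases hab : a = j
    · subst hab
      simp only [Matrix.updateRow_self]
      exact contDiffOn_const
    · simp only [Matrix.updateRow_ne hab]
      exact hA a b
  have h : ContDiffOn ℝ ∞ (fun x => (A x).det⁻¹ * (A x).adjugate i j) s :=
    ((hd A hA).inv hdet).mul hadj
  refine h.congr fun x hx => ?_
  simp [Matrix.inv_def, Ring.inverse_eq_inv']

theorem continuousOn_matrix_inv {X : Type*} [TopologicalSpace X] {s : Set X}
    {A : X → Matrix (Fin l) (Fin l) ℝ} (hA : ContinuousOn A s)
    (hdet : ∀ x ∈ s, (A x).det ≠ 0) : ContinuousOn (fun x => (A x)⁻¹) s := by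
  have h : ContinuousOn (fun x => (A x).det⁻¹ • (A x).adjugate) s :=
    ContinuousOn.smul
      (ContinuousOn.inv₀ ((continuous_id.matrix_det).comp_continuousOn hA) hdet)
      ((continuous_id.matrix_adjugate).comp_continuousOn hA)
  refine h.congr fun x _ => ?_
  simp [Matrix.inv_def, Ring.inverse_eq_inv']

theorem continuousOn_coord (I : IndexSet n l) : ContinuousOn (coord I) (chartDomain I) := by
  have h1 : ContinuousOn
      (fun ν => ((projCols I ν) * ((projCols I ν).submatrix I.row id)⁻¹).submatrix I.coRow id)
      (chartDomain I) := by
    have hinv := continuousOn_matrix_inv (s := chartDomain I)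
      ((continuous_projCols I).matrix_submatrix I.row id).continuousOn
      fun ν hν => (mem_chartDomain_iff I ν).1 hν
    have hmul : ContinuousOn
        (fun ν => (projCols I ν) * ((projCols I ν).submatrix I.row id)⁻¹) (chartDomain I) := by
      rw [continuousOn_iff_continuous_domRestrict] at hinv ⊢
      exact ((continuous_projCols I).comp continuous_subtype_val).matrix_mul hinv
    exact (continuous_id.matrix_submatrix I.coRow id).comp_continuousOn hmul
  refine h1.congr fun ν hν => ?_
  obtain ⟨Y, hY, hdet⟩ := hν
  rw [coord_eq I hY hdet, ← normalForm_projCols I hY hdet]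
  rfl

theorem contDiff_stack_apply (I : IndexSet n l) (i : Fin n) (j : Fin l) :
    ContDiff ℝ ∞ fun M : Model n l => stack I M i j := by
  by_cases h : i ∈ I.toFinset
  · simp only [stack, h, dif_pos]
    exact contDiff_const
  · simp only [stack, h, dif_neg, not_false_eq_true]
    exact contDiff_apply_apply ℝ ℝ _ _

theorem continuous_coordInv (I : IndexSet n l) : Continuous (coordInv I) := by
  rw [continuous_induced_rng]
  have hstack : Continuous (stack I) :=
    continuous_matrix fun i j => (contDiff_stack_apply I i j).continuous
  have hinv : Continuous fun M => ((stack I M)ᵀ * stack I M)⁻¹ := by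
    rw [← continuousOn_univ]
    exact continuousOn_matrix_inv (hstack.matrix_transpose.matrix_mul hstack).continuousOn
      fun M _ => (isUnit_gram (mulVec_injective_of_det (det_stack_row I M))).ne_zero
  have hlin : Continuous (Matrix.toEuclideanCLM (n := Fin n) (𝕜 := ℝ)) :=
    LinearMap.continuous_of_finiteDimensional
      ((Matrix.toEuclideanCLM (n := Fin n) (𝕜 := ℝ)).toAlgEquiv.toLinearMap)
  have h := hlin.comp ((hstack.matrix_mul hinv).matrix_mul hstack.matrix_transpose)
  refine h.congr fun M => ?_
  exact (starProjection_colSpan (mulVec_injective_of_det (det_stack_row I M))).symm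

/-- The chart `(U_I, φ_I)`. -/
noncomputable def chart (I : IndexSet n l) :
    OpenPartialHomeomorph (Grassmannian n l) (Model n l) where
  toFun := coord I
  invFun := coordInv I
  source := chartDomain I
  target := Set.univ
  map_source' _ _ := Set.mem_univ _
  map_target' M _ := coordInv_mem I M
  left_inv' _ hν := coordInv_coord I hν
  right_inv' M _ := coord_coordInv I M
  open_source := isOpen_chartDomain I
  open_target := isOpen_univ
  continuousOn_toFun := continuousOn_coord I
  continuousOn_invFun := (continuous_coordInv I).continuousOn

/-- The domains `U_I` cover the Grassmannian. -/
theorem exists_mem_chartDomain (ν : Grassmannian n l) : ∃ I : IndexSet n l, ν ∈ chartDomain I := by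
  obtain ⟨Y, hY, h⟩ := exists_colSpan ν
  obtain ⟨κ, a, ha, hspan, hli⟩ := exists_linearIndependent' ℝ Y.row
  have : Fintype κ := Fintype.ofInjective a ha
  have hcol : LinearIndependent ℝ Y.col := Matrix.mulVec_injective_iff.1 h
  have hκ : Fintype.card κ = l := by
    rw [← finrank_span_eq_card hli, hspan, ← Matrix.rank_eq_finrank_span_row,
      Matrix.rank_eq_finrank_span_cols, finrank_span_eq_card hcol, Fintype.card_fin]
  let I : IndexSet n l := ⟨Finset.univ.map ⟨a, ha⟩, by rw [Finset.card_map, Finset.card_univ, hκ]⟩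
  have hrow : ∀ i : Fin l, ∃ j : κ, a j = I.row i := by
    intro i
    have := row_mem I i
    simpa [I] using this
  choose b hb using hrow
  have hbinj : Function.Injective b := by
    intro i j hij
    apply I.row.injective
    rw [← hb, ← hb, hij]
  refine ⟨I, Y, hY, ?_⟩
  have hli' : LinearIndependent ℝ (Y.submatrix I.row id).row := by
    have h1 := hli.comp b hbinj
    have h2 : (Y.row ∘ a) ∘ b = (Y.submatrix I.row id).row := by
      funext i
      change Y (a (b i)) = Y (I.row i)
      rw [hb]
    rwa [h2] at h1
  rw [Matrix.linearIndependent_rows_iff_isUnit, Matrix.isUnit_iff_isUnit_det] at hli'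
  exact hli'.ne_zero

/-! ### The smooth structure and sets of measure zero -/

/-- The Grassmannian with the atlas `{(U_I, φ_I)}`. -/
noncomputable instance : ChartedSpace (Model n l) (Grassmannian n l) where
  atlas := Set.range chart
  chartAt ν := chart (exists_mem_chartDomain ν).choose
  mem_chart_source ν := (exists_mem_chartDomain ν).choose_spec
  chart_mem_atlas _ := Set.mem_range_self _

/-- Any two of the charts `(U_I, φ_I)` are `C^∞` compatible. -/
instance : IsManifold 𝓘(ℝ, Model n l) ∞ (Grassmannian n l) := by
  apply isManifold_of_contDiffOn
  rintro _ _ ⟨I, rfl⟩ ⟨K, rfl⟩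
  simp only [mfld_simps]
  have hsub : ∀ i j, ContDiff ℝ ∞ fun M : Model n l => (stack I M).submatrix K.row id i j :=
    fun i j => contDiff_stack_apply I _ _
  have hset : ∀ M ∈ coordInv I ⁻¹' chartDomain K,
      ((stack I M).submatrix K.row id).det ≠ 0 := fun M hM =>
    det_ne_zero_of_mem hM rfl (mulVec_injective_of_det (det_stack_row I M))
  have hfun : ContDiffOn ℝ ∞ (fun M => normalForm K (stack I M))
      (coordInv I ⁻¹' chartDomain K) := by
    rw [contDiffOn_pi]
    intro i
    rw [contDiffOn_pi]
    intro j
    simp only [normalForm, Matrix.submatrix_apply, Matrix.mul_apply]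
    refine ContDiffOn.sum fun c _ => ?_
    exact (contDiff_stack_apply I _ _).contDiffOn.mul
      (contDiffOn_inv_apply (fun i j => (hsub i j).contDiffOn) hset _ _)
  have hcongr : ContDiffOn ℝ ∞ (fun M => coord K (coordInv I M))
      (coordInv I ⁻¹' chartDomain K) :=
    hfun.congr fun M hM => coord_eq (ν := coordInv I M) K rfl (hset M hM)
  exact hcongr.mono fun M hM => hM.2

/-- A subset `A` of the Grassmannian has measure zero if `φ(A ∩ U)` has Lebesgue measure zero for
every chart `(U, φ)` of its smooth structure. -/
def HasMeasureZero (A : Set (Grassmannian n l)) : Prop :=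
  ∀ φ ∈ IsManifold.maximalAtlas 𝓘(ℝ, Model n l) ∞ (Grassmannian n l),
    volume (φ '' (A ∩ φ.source)) = 0

end Grassmannian

/-! ### The exact recovery set -/

/-- The set `Ω_J(n, k, l)` of those `ν ∈ G_l(ℝⁿ)` with `J(z_T) < J(z_{Tᶜ})` for all nonzero `z ∈ ν`
and all `T` with at most `k` elements. -/
def exactRecoverySet (F : ℝ≥0 → ℝ≥0) (n k l : ℕ) : Set (Grassmannian n l) :=
  {ν | ∀ z ∈ ν.toSubmodule, z ≠ 0 → ∀ T : Finset (Fin n), T.card ≤ k → cost F T z < cost F Tᶜ z}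

end SparseRecovery

/-!
By compactness, a subspace `ν` which is not an interior point of the set of subspaces avoiding the
cone `B` of vectors that are at least as costly on `T` as off `T` contains a nonzero vector `u` of
`closure B`. As `F` is monotone, a small displacement of `u` which increases `|u i|` for `i ∈ T` and
decreases it for `i ∉ T` leads into `B`. The coordinates off `T` at which `u` vanishes must be kept
fixed; generically they lie in some index set `K`, and in the chart of `K` the coordinates in `K`
can be prescribed. So some open cone of directions in that chart leads immediately out of the
avoiding set, and by the Lebesgue density theorem the points of the closure of a set at which this
happens form a null set.
-/

namespace SparseRecovery

open Filter Metric Topology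
open scoped Pointwise

section NullSets

variable {E : Type*} [NormedAddCommGroup E] [NormedSpace ℝ E] [FiniteDimensional ℝ E]
  [MeasurableSpace E] [BorelSpace E] (μ : Measure E) [μ.IsAddHaarMeasure]

theorem ae_restrict_closure_frequently_add_smul_mem (s : Set E) :
    ∀ᵐ x ∂μ.restrict (closure s), ∀ v, ∃ᶠ p in 𝓝[>] (0 : ℝ) ×ˢ 𝓝 v, x + p.1 • p.2 ∈ s := by
  filter_upwards [Besicovitch.ae_tendsto_measure_inter_div μ (closure s)] with x hx v hnot
  obtain ⟨S, hS, U, hU, hSU⟩ := eventually_prod_iff.1 hnot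
  obtain ⟨δ, hδ, hball⟩ := Metric.eventually_nhds_iff_ball.1 hU
  have hmeet := Measure.eventually_nonempty_inter_smul_of_density_one μ (closure s) x hx
    (ball v δ) measurableSet_ball (measure_ball_pos μ v hδ).ne'
  obtain ⟨t, ⟨htS, ht⟩, ht₀⟩ := ((hS.and hmeet).and self_mem_nhdsWithin).exists
  have hopen : IsOpen ({x} + t • ball v δ) := (isOpen_ball.smul₀ (ne_of_gt ht₀)).add_left
  obtain ⟨_, ⟨_, rfl, _, ⟨w, hw, rfl⟩, rfl⟩, hs⟩ :=
    (closure_inter_open_nonempty_iff hopen).1 ht |>.mono (Set.inter_comm _ _).subset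
  exact hSU htS (hball w hw) hs

theorem measure_eq_zero_of_eventually_add_smul_notMem {s A : Set E} (hA : A ⊆ closure s)
    (h : ∀ x ∈ A, ∃ v, ∀ᶠ p in 𝓝[>] (0 : ℝ) ×ˢ 𝓝 v, x + p.1 • p.2 ∉ s) : μ A = 0 := by
  have hae := ae_mono (Measure.restrict_mono hA le_rfl)
    (ae_restrict_closure_frequently_add_smul_mem μ s)
  refine (Measure.restrict_apply_self μ A).symm.trans (measure_mono_null (fun x hx => ?_) hae)
  obtain ⟨v, hv⟩ := h x hx
  exact fun hfreq => hfreq v hv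

theorem measure_zeros_eq_zero_of_lines {f : E → ℝ} (hf : Continuous f) (x₀ : E)
    (h : ∀ x, volume {t : ℝ | f (x₀ + t • x) = 0} = 0) : μ {x | f x = 0} = 0 := by
  have hclosed : IsClosed {p : ℝ × E | f (x₀ + p.1 • p.2) = 0} :=
    isClosed_eq (by fun_prop) continuous_const
  have hprod : (volume.prod μ) {p : ℝ × E | f (x₀ + p.1 • p.2) = 0} = 0 := by
    rw [Measure.prod_apply_symm hclosed.measurableSet]
    simp only [Set.preimage_ofPred_eq, h, lintegral_zero]
  have hae := (Measure.measure_prod_null hclosed.measurableSet).1 hprod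
  obtain ⟨t, ht, ht₀⟩ := (hae.and (Measure.ae_ne volume (0 : ℝ))).exists
  have himage : {x | f x = 0} = (x₀ + ·) '' (t • {x | f (x₀ + t • x) = 0}) := by
    ext x
    constructor
    · intro hx
      have hx' : x₀ + t • t⁻¹ • (x - x₀) = x := by rw [smul_inv_smul₀ ht₀, add_sub_cancel]
      exact ⟨t • t⁻¹ • (x - x₀), Set.smul_mem_smul_set (hx'.symm ▸ hx : f _ = 0), hx'⟩
    · rintro ⟨_, ⟨y, hy, rfl⟩, rfl⟩
      exact hy
  have ht : μ {x | f (x₀ + t • x) = 0} = 0 := ht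
  rw [himage, Set.image_add_left, measure_preimage_add, Measure.addHaar_smul, ht, mul_zero]

end NullSets

theorem frontier_iInter_subset {X ι : Type*} [TopologicalSpace X] [Finite ι] (s : ι → Set X) :
    frontier (⋂ i, s i) ⊆ ⋃ i, frontier (s i) := by
  rintro x ⟨hcl, hint⟩
  rw [interior_iInter_of_finite, Set.mem_iInter, not_forall] at hint
  obtain ⟨i, hi⟩ := hint
  exact Set.mem_iUnion.2 ⟨i, closure_mono (Set.iInter_subset s i) hcl, hi⟩

theorem finite_setOf_det_add_smul_eq_zero {R m : Type*} [CommRing R] [IsDomain R] [Fintype m]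
    [DecidableEq m] {A : Matrix m m R} (hA : A.det ≠ 0) (B : Matrix m m R) :
    {t : R | (A + t • B).det = 0}.Finite := by
  let p : Polynomial R :=
    ((Polynomial.X : Polynomial R) • B.map Polynomial.C + A.map Polynomial.C).det
  have heval (t : R) : p.eval t = (A + t • B).det := by
    rw [← Polynomial.coe_evalRingHom, RingHom.map_det]
    congr 1
    ext i j
    simp only [RingHom.mapMatrix_apply, Matrix.map_apply, Matrix.add_apply, Matrix.smul_apply,
      smul_eq_mul, map_add, Polynomial.coe_evalRingHom, Polynomial.eval_mul, Polynomial.eval_X,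
      Polynomial.eval_C, add_comm]
  have hp : p ≠ 0 := fun h => hA <| by
    rw [← Polynomial.coeff_det_X_add_C_zero B A]
    exact congrArg (Polynomial.coeff · 0) h
  exact (Polynomial.finite_setOfPred_isRoot hp).subset fun t ht => (heval t).trans ht

theorem exists_eventually_abs_add_half_le_abs_add_mul (x : ℝ) :
    ∃ s, ∀ᶠ p in 𝓝[>] (0 : ℝ) ×ˢ 𝓝 s, |x| + p.1 / 2 ≤ |x + p.1 * p.2| := by
  have hpos : ∀ᶠ t in 𝓝[>] (0 : ℝ), 0 < t := self_mem_nhdsWithin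
  rcases le_total 0 x with hx | hx
  · refine ⟨1, (hpos.prod_mk (Ioi_mem_nhds (by norm_num : (1 / 2 : ℝ) < 1))).mono ?_⟩
    rintro ⟨t, v⟩ ⟨ht, hv : 1 / 2 < v⟩
    rw [abs_of_nonneg hx]
    refine le_trans ?_ (le_abs_self _)
    nlinarith
  · refine ⟨-1, (hpos.prod_mk (Iio_mem_nhds (by norm_num : (-1 : ℝ) < -1 / 2))).mono ?_⟩
    rintro ⟨t, v⟩ ⟨ht, hv : v < -1 / 2⟩
    rw [abs_of_nonpos hx]
    refine le_trans ?_ (neg_le_abs _)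
    nlinarith

theorem exists_eventually_abs_add_mul_add_half_le_abs {x : ℝ} (hx : x ≠ 0) :
    ∃ s, ∀ᶠ p in 𝓝[>] (0 : ℝ) ×ˢ 𝓝 s, |x + p.1 * p.2| + p.1 / 2 ≤ |x| := by
  have hsmall : ∀ᶠ t in 𝓝[>] (0 : ℝ), t ∈ Set.Ioo 0 (|x| / 2) :=
    Ioo_mem_nhdsGT (half_pos (abs_pos.2 hx))
  rcases hx.lt_or_gt with hx | hx
  · refine ⟨1, (hsmall.prod_mk (Ioo_mem_nhds (by norm_num : (1 / 2 : ℝ) < 1)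
      one_lt_two)).mono ?_⟩
    rintro ⟨t, v⟩ ⟨⟨ht, htx⟩, hv, hv'⟩
    rw [abs_of_neg hx] at htx ⊢
    rw [abs_of_nonpos] <;> nlinarith
  · refine ⟨-1, (hsmall.prod_mk (Ioo_mem_nhds (by norm_num : (-2 : ℝ) < -1)
      (by norm_num : (-1 : ℝ) < -1 / 2))).mono ?_⟩
    rintro ⟨t, v⟩ ⟨⟨ht, htx⟩, hv, hv'⟩
    rw [abs_of_pos hx] at htx ⊢
    rw [abs_of_nonneg] <;> nlinarith

/-- A set of vectors which is closed under passing to dominating vectors: those with larger moduli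
in the coordinates in `T` and smaller moduli in the others. -/
def IsDominanceClosed {ι : Type*} (T : Set ι) (B : Set (EuclideanSpace ℝ ι)) : Prop :=
  ∀ ⦃z w⦄, z ∈ B → (∀ i ∈ T, |z i| ≤ |w i|) → (∀ i ∉ T, |w i| ≤ |z i|) → w ∈ B

namespace IsDominanceClosed

variable {ι : Type*} [Finite ι] {T : Set ι} {B : Set (EuclideanSpace ℝ ι)}

theorem mem_of_abs_add_le (hB : IsDominanceClosed T B) {u w : EuclideanSpace ℝ ι}
    (hu : u ∈ closure B) {δ : ℝ} (hδ : 0 < δ) (hT : ∀ i ∈ T, |u i| + δ ≤ |w i|)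
    (hTc : ∀ i ∉ T, w i = 0 ∨ |w i| + δ ≤ |u i|) : w ∈ B := by
  have hnear : ∀ᶠ z in 𝓝 u, ∀ i, |z i - u i| < δ := by
    have hcont (i : ι) : Continuous fun z : EuclideanSpace ℝ ι => z i := by fun_prop
    exact eventually_all.2 fun i => (hcont i).continuousAt.eventually (ball_mem_nhds (u i) hδ)
  obtain ⟨z, hz, hzu⟩ := ((mem_closure_iff_frequently.1 hu).and_eventually hnear).exists
  refine hB hz (fun i hi => ?_) fun i hi => ?_
  · linarith [abs_sub_abs_le_abs_sub (z i) (u i), hzu i, hT i hi]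
  · rcases hTc i hi with hwi | hwi
    · exact hwi ▸ abs_zero.trans_le (abs_nonneg _)
    · linarith [abs_sub_abs_le_abs_sub (u i) (z i), abs_sub_comm (u i) (z i), hzu i]

theorem exists_eventually_add_smul_mem (hB : IsDominanceClosed T B) {u : EuclideanSpace ℝ ι}
    (hu : u ∈ closure B) :
    ∃ s : EuclideanSpace ℝ ι, (∀ i ∉ T, u i = 0 → s i = 0) ∧
      ∀ᶠ p in 𝓝[>] (0 : ℝ) ×ˢ 𝓝 s, (∀ i ∉ T, u i = 0 → p.2 i = 0) → u + p.1 • p.2 ∈ B := by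
  have hcoord (i : ι) : ∃ s : ℝ, (i ∉ T → u i = 0 → s = 0) ∧
      ∀ᶠ p in 𝓝[>] (0 : ℝ) ×ˢ 𝓝 s, (i ∈ T → |u i| + p.1 / 2 ≤ |u i + p.1 * p.2|) ∧
        (i ∉ T → u i ≠ 0 → |u i + p.1 * p.2| + p.1 / 2 ≤ |u i|) := by
    by_cases hi : i ∈ T
    · obtain ⟨s, hs⟩ := exists_eventually_abs_add_half_le_abs_add_mul (u i)
      exact ⟨s, absurd hi, hs.mono fun p hp => ⟨fun _ => hp, absurd hi⟩⟩
    · by_cases hui : u i = 0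
      · exact ⟨0, fun _ _ => rfl, .of_forall fun p => ⟨(absurd · hi), fun _ => absurd hui⟩⟩
      · obtain ⟨s, hs⟩ := exists_eventually_abs_add_mul_add_half_le_abs hui
        exact ⟨s, fun _ => (absurd · hui), hs.mono fun p hp => ⟨(absurd · hi), fun _ _ => hp⟩⟩
  choose s hs₀ hs using hcoord
  refine ⟨WithLp.toLp 2 s, hs₀, ?_⟩
  have hev : ∀ᶠ p in 𝓝[>] (0 : ℝ) ×ˢ 𝓝 (WithLp.toLp 2 s), ∀ i,
      (i ∈ T → |u i| + p.1 / 2 ≤ |u i + p.1 * p.2 i|) ∧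
        (i ∉ T → u i ≠ 0 → |u i + p.1 * p.2 i| + p.1 / 2 ≤ |u i|) := by
    refine eventually_all.2 fun i => ?_
    have hi : Tendsto (fun v : EuclideanSpace ℝ ι => v i) (𝓝 (WithLp.toLp 2 s)) (𝓝 (s i)) :=
      Continuous.tendsto (by fun_prop) (WithLp.toLp 2 s)
    exact (tendsto_id.prodMap hi).eventually (hs i)
  have hpos : ∀ᶠ t in 𝓝[>] (0 : ℝ), 0 < t := self_mem_nhdsWithin
  filter_upwards [hev, hpos.prod_inl _] with p hp ht hp₀
  refine hB.mem_of_abs_add_le hu (half_pos ht) (fun i hi => (hp i).1 hi) fun i hi => ?_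
  by_cases hui : u i = 0
  · left
    simp [hui, hp₀ i hi hui]
  · exact .inr ((hp i).2 hi hui)

end IsDominanceClosed

namespace Grassmannian

variable {n l : ℕ}

theorem HasMeasureZero.mono {A B : Set (Grassmannian n l)} (hB : HasMeasureZero B) (h : A ⊆ B) :
    HasMeasureZero A := fun φ hφ =>
  measure_mono_null (Set.image_mono (Set.inter_subset_inter_left _ h)) (hB φ hφ)

theorem HasMeasureZero.iUnion {ι : Sort*} [Countable ι] {A : ι → Set (Grassmannian n l)}
    (h : ∀ i, HasMeasureZero (A i)) : HasMeasureZero (⋃ i, A i) := by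
  intro φ hφ
  rw [Set.iUnion_inter, Set.image_iUnion]
  exact measure_iUnion_null fun i => h i φ hφ

theorem HasMeasureZero.union {A B : Set (Grassmannian n l)} (hA : HasMeasureZero A)
    (hB : HasMeasureZero B) : HasMeasureZero (A ∪ B) := by
  intro φ hφ
  rw [Set.union_inter_distrib_right, Set.image_union]
  exact measure_union_null (hA φ hφ) (hB φ hφ)

theorem chart_mem_maximalAtlas (K : IndexSet n l) :
    chart K ∈ IsManifold.maximalAtlas 𝓘(ℝ, Model n l) ∞ (Grassmannian n l) :=
  IsManifold.subset_maximalAtlas (Set.mem_range_self K)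

theorem hasMeasureZero_of_coord {K : IndexSet n l} {A : Set (Grassmannian n l)}
    (hA : A ⊆ chartDomain K) (h : volume (coord K '' A) = 0) : HasMeasureZero A := by
  intro φ hφ
  have hmem := IsManifold.compatible_of_mem_maximalAtlas (chart_mem_maximalAtlas K) hφ
  have hdiff : ContDiffOn ℝ ∞ (fun M => φ (coordInv K M)) (coordInv K ⁻¹' φ.source) := by
    rw [contDiffGroupoid, mem_groupoid_of_pregroupoid] at hmem
    simpa [contDiffPregroupoid, chart, Function.comp_def] using hmem.1
  have hsub : coord K '' (A ∩ φ.source) ⊆ coordInv K ⁻¹' φ.source := by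
    rintro _ ⟨ν, hν, rfl⟩
    rw [Set.mem_preimage, coordInv_coord K (hA hν.1)]
    exact hν.2
  have himage : φ '' (A ∩ φ.source)
      = (fun M => φ (coordInv K M)) '' (coord K '' (A ∩ φ.source)) := by
    rw [Set.image_image]
    refine Set.image_congr fun ν hν => ?_
    rw [coordInv_coord K (hA hν.1)]
  rw [himage]
  exact addHaar_image_eq_zero_of_differentiableOn_of_addHaar_eq_zero volume
    ((hdiff.differentiableOn (by simp)).mono hsub)
    (measure_mono_null (Set.image_mono Set.inter_subset_left) h)

theorem HasMeasureZero.interior_eq_empty {A : Set (Grassmannian n l)} (h : HasMeasureZero A) :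
    interior A = ∅ := by
  rw [Set.eq_empty_iff_forall_notMem]
  intro ν hν
  obtain ⟨K, hK⟩ := exists_mem_chartDomain ν
  have hopen : IsOpen (chart K '' (interior A ∩ (chart K).source)) :=
    (chart K).isOpen_image_of_subset_source (isOpen_interior.inter (chart K).open_source)
      Set.inter_subset_right
  have hnull := (h.mono interior_subset) (chart K) (chart_mem_maximalAtlas K)
  rw [hopen.measure_eq_zero_iff (μ := volume)] at hnull
  exact Set.eq_empty_iff_forall_notMem.1 hnull _ ⟨ν, ⟨hν, hK⟩, rfl⟩

theorem HasMeasureZero.isMeagre {A : Set (Grassmannian n l)} (h : HasMeasureZero A)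
    (hA : IsClosed A) : IsMeagre A :=
  (hA.isNowhereDense_iff.2 h.interior_eq_empty).isMeagre

theorem isOpenEmbedding_coordInv (K : IndexSet n l) : IsOpenEmbedding (coordInv K) :=
  (chart K).symm.isOpenEmbedding rfl

theorem hasMeasureZero_of_eventually_coordInv_notMem {K : IndexSet n l}
    {Ω A : Set (Grassmannian n l)} (hAΩ : A ⊆ closure Ω) (hAK : A ⊆ chartDomain K)
    (h : ∀ ν ∈ A, ∃ D : Model n l, ∀ᶠ p in 𝓝[>] (0 : ℝ) ×ˢ 𝓝 D,
      coordInv K (coord K ν + p.1 • p.2) ∉ Ω) : HasMeasureZero A := by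
  refine hasMeasureZero_of_coord hAK
    (measure_eq_zero_of_eventually_add_smul_notMem volume (s := coordInv K ⁻¹' Ω) ?_ ?_)
  · rintro _ ⟨ν, hν, rfl⟩
    apply (isOpenEmbedding_coordInv K).isOpenMap.preimage_closure_subset_closure_preimage
    rw [Set.mem_preimage, coordInv_coord K (hAK hν)]
    exact hAΩ hν
  · rintro _ ⟨ν, hν, rfl⟩
    exact h ν hν

theorem row_or_coRow (K : IndexSet n l) (i : Fin n) :
    (∃ a, K.row a = i) ∨ ∃ b, K.coRow b = i := by
  change i ∈ Set.range K.row ∨ i ∈ Set.range K.coRow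
  rw [IndexSet.row, IndexSet.coRow, Finset.range_orderEmbOfFin, Finset.range_orderEmbOfFin,
    Finset.coe_compl]
  exact em _

theorem exists_row_eq {K : IndexSet n l} {i : Fin n} (hi : i ∈ K.toFinset) :
    ∃ a, K.row a = i :=
  (row_or_coRow K i).resolve_right fun ⟨b, hb⟩ => coRow_notMem K b (hb ▸ hi)

theorem continuous_stack (K : IndexSet n l) : Continuous (stack K) :=
  continuous_matrix fun i j => (contDiff_stack_apply K i j).continuous

theorem stack_add_smul (K : IndexSet n l) (M N : Model n l) (t : ℝ) :
    stack K (M + t • N) = stack K M + t • (stack K N - stack K 0) := by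
  ext i j
  by_cases h : i ∈ K.toFinset <;> simp [stack, h]

theorem stack_mulVec_row (K : IndexSet n l) (M : Model n l) (c : Fin l → ℝ) (a : Fin l) :
    (stack K M *ᵥ c) (K.row a) = c a := by
  have h : ((stack K M).submatrix K.row id *ᵥ c) a = c a := by
    rw [stack_row, Matrix.one_mulVec]
  exact h

theorem stack_mulVec_coRow (K : IndexSet n l) (M : Model n l) (c : Fin l → ℝ)
    (b : Fin (n - l)) : (stack K M *ᵥ c) (K.coRow b) = M b ⬝ᵥ c :=
  congrArg (· ⬝ᵥ c) (congrFun (stack_coRow K M) b)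

instance : Finite (IndexSet n l) :=
  Finite.of_injective IndexSet.toFinset fun I J h => by
    cases I
    cases J
    simpa using h

theorem exists_forall_mem_chartDomain (I : IndexSet n l) :
    ∃ ν : Grassmannian n l, ∀ K : IndexSet n l, ν ∈ chartDomain K := by
  let Y : Matrix (Fin n) (Fin l) ℝ := Matrix.of fun i j => (i : ℝ) ^ (j : ℕ)
  have hY (K : IndexSet n l) : (Y.submatrix K.row id).det ≠ 0 := by
    have hvandermonde : Y.submatrix K.row id = Matrix.vandermonde fun a => ((K.row a : ℕ) : ℝ) := by
      ext
      rfl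
    rw [hvandermonde, Matrix.det_vandermonde_ne_zero_iff]
    exact Nat.cast_injective.comp (Fin.val_injective.comp K.row.injective)
  exact ⟨⟨colSpan Y, finrank_colSpan (mulVec_injective_of_det (hY I))⟩, fun K => ⟨Y, rfl, hY K⟩⟩

theorem coordInv_mem_chartDomain_iff {I K : IndexSet n l} {M : Model n l} :
    coordInv I M ∈ chartDomain K ↔ ((stack I M).submatrix K.row id).det ≠ 0 :=
  ⟨fun h => det_ne_zero_of_mem h rfl (mulVec_injective_of_det (det_stack_row I M)),
    fun h => ⟨stack I M, rfl, h⟩⟩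

theorem hasMeasureZero_chartDomain_diff_chartDomain (I K : IndexSet n l) :
    HasMeasureZero (chartDomain I \ chartDomain K) := by
  obtain ⟨ν₀, hν₀⟩ := exists_forall_mem_chartDomain I
  have hdet₀ : ((stack I (coord I ν₀)).submatrix K.row id).det ≠ 0 := by
    rw [← coordInv_mem_chartDomain_iff, coordInv_coord I (hν₀ I)]
    exact hν₀ K
  have hzeros : volume {M : Model n l | ((stack I M).submatrix K.row id).det = 0} = 0 := by
    refine measure_zeros_eq_zero_of_lines volume
      ((continuous_stack I).matrix_submatrix _ _).matrix_det (coord I ν₀) fun N => ?_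
    simp only [stack_add_smul, Matrix.submatrix_add, Matrix.submatrix_smul, Pi.add_apply,
      Pi.smul_apply]
    exact (finite_setOf_det_add_smul_eq_zero hdet₀ _).measure_zero volume
  refine hasMeasureZero_of_coord Set.sdiff_subset (measure_mono_null ?_ hzeros)
  rintro _ ⟨ν, ⟨hI, hK⟩, rfl⟩
  by_contra hdet
  exact hK (coordInv_coord I hI ▸ coordInv_mem_chartDomain_iff.2 hdet)

theorem hasMeasureZero_compl_iInter_chartDomain :
    HasMeasureZero (⋂ K : IndexSet n l, chartDomain K)ᶜ := by
  refine (HasMeasureZero.iUnion fun I => HasMeasureZero.iUnion fun K =>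
    hasMeasureZero_chartDomain_diff_chartDomain (n := n) (l := l) I K).mono fun ν hν => ?_
  obtain ⟨I, hI⟩ := exists_mem_chartDomain ν
  obtain ⟨K, hK⟩ := not_forall.1 (mt Set.mem_iInter.2 hν)
  exact Set.mem_iUnion₂.2 ⟨I, K, hI, hK⟩

theorem eq_zero_of_mem_chartDomain {K : IndexSet n l} {ν : Grassmannian n l}
    (hν : ν ∈ chartDomain K) {z : EuclideanSpace ℝ (Fin n)} (hz : z ∈ ν.toSubmodule)
    (h : ∀ i ∈ K.toFinset, z i = 0) : z = 0 := by
  obtain ⟨Y, hY, hdet⟩ := hν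
  rw [← hY, mem_colSpan] at hz
  obtain ⟨c, rfl⟩ := hz
  have hc : c = 0 := by
    apply Matrix.mulVec_injective_of_det_ne_zero hdet
    rw [Matrix.mulVec_zero]
    exact funext fun a => h _ (row_mem K a)
  rw [hc, Matrix.mulVec_zero, WithLp.toLp_zero]

theorem exists_indexSet_of_forall_mem_chartDomain {ν : Grassmannian n l}
    (hν : ∀ K, ν ∈ chartDomain K) {z : EuclideanSpace ℝ (Fin n)} (hz : z ∈ ν.toSubmodule)
    (hz₀ : z ≠ 0) : ∃ K : IndexSet n l, ∀ i, z i = 0 → i ∈ K.toFinset := by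
  let S : Finset (Fin n) := {i | z i = 0}
  have hS {i : Fin n} : i ∈ S ↔ z i = 0 := Finset.mem_filter_univ i
  have hcard : S.card ≤ l := by
    by_contra! hlt
    obtain ⟨R, hRS, hR⟩ := Finset.exists_subset_card_eq hlt.le
    exact hz₀ (eq_zero_of_mem_chartDomain (hν ⟨R, hR⟩) hz fun i hi => hS.1 (hRS hi))
  obtain ⟨I, -⟩ := exists_mem_chartDomain ν
  obtain ⟨K, hSK, -, hK⟩ := Finset.exists_subsuperset_card_eq (Finset.subset_univ S) hcard
    (I.card_eq ▸ Finset.card_le_univ I.toFinset)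
  exact ⟨⟨K, hK⟩, fun i hi => hSK (hS.2 hi)⟩

/-- The derivative of `(M, c) ↦ stack K M *ᵥ c` at `(M, c)` in the direction `(G, σ)`. -/
noncomputable def stackDeriv (K : IndexSet n l) (M : Model n l) (c : Fin l → ℝ) (G : Model n l)
    (σ : Fin l → ℝ) : EuclideanSpace ℝ (Fin n) :=
  WithLp.toLp 2 (stack K M *ᵥ σ + (stack K G - stack K 0) *ᵥ c)

-- Taking the derivative at `(M, c + t • σ)` instead of `(M, c)` absorbs the second order term.
theorem stack_add_smul_mulVec_add_smul (K : IndexSet n l) (M G : Model n l) (c σ : Fin l → ℝ)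
    (t : ℝ) : WithLp.toLp 2 (stack K (M + t • G) *ᵥ (c + t • σ)) =
      WithLp.toLp 2 (stack K M *ᵥ c) + t • stackDeriv K M (c + t • σ) G σ := by
  rw [stackDeriv, ← WithLp.toLp_smul, ← WithLp.toLp_add, stack_add_smul, Matrix.add_mulVec,
    Matrix.mulVec_add (stack K M), Matrix.mulVec_smul, Matrix.smul_mulVec, smul_add, add_assoc]

theorem stackDeriv_row (K : IndexSet n l) (M : Model n l) (c : Fin l → ℝ) (G : Model n l)
    (σ : Fin l → ℝ) (a : Fin l) : stackDeriv K M c G σ (K.row a) = σ a := by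
  rw [stackDeriv, PiLp.toLp_apply, Pi.add_apply, Matrix.sub_mulVec, Pi.sub_apply,
    stack_mulVec_row, stack_mulVec_row, stack_mulVec_row, sub_self, add_zero]

theorem stackDeriv_coRow (K : IndexSet n l) (M : Model n l) (c : Fin l → ℝ) (G : Model n l)
    (σ : Fin l → ℝ) (b : Fin (n - l)) :
    stackDeriv K M c G σ (K.coRow b) = M b ⬝ᵥ σ + G b ⬝ᵥ c := by
  rw [stackDeriv, PiLp.toLp_apply, Pi.add_apply, Matrix.sub_mulVec, Pi.sub_apply,
    stack_mulVec_coRow, stack_mulVec_coRow, stack_mulVec_coRow, Pi.zero_apply, zero_dotProduct,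
    sub_zero]

theorem exists_stackDeriv_eq (K : IndexSet n l) (M : Model n l) {c : Fin l → ℝ} (hc : c ≠ 0)
    (s : EuclideanSpace ℝ (Fin n)) : ∃ D : Model n l, stackDeriv K M c D (s ∘ K.row) = s := by
  have hcc : c ⬝ᵥ c ≠ 0 := mt dotProduct_self_eq_zero.1 hc
  refine ⟨fun b => ((s (K.coRow b) - M b ⬝ᵥ (s ∘ K.row)) / (c ⬝ᵥ c)) • c, ?_⟩
  ext i
  obtain ⟨a, rfl⟩ | ⟨b, rfl⟩ := row_or_coRow K i
  · exact stackDeriv_row K M c _ _ a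
  · rw [stackDeriv_coRow, smul_dotProduct, smul_eq_mul, div_mul_cancel₀ _ hcc, add_sub_cancel]

theorem continuous_stackDeriv (K : IndexSet n l) (M : Model n l) (σ : Fin l → ℝ) :
    Continuous fun q : (Fin l → ℝ) × Model n l => stackDeriv K M q.1 q.2 σ := by
  have hstack := continuous_stack K
  unfold stackDeriv
  fun_prop

/-- The subspaces whose only possible vector in the set `B` is zero. The exact recovery set is a
finite intersection of such sets. -/
def avoidingSet (l : ℕ) (B : Set (EuclideanSpace ℝ (Fin n))) : Set (Grassmannian n l) :=
  {ν | ∀ z ∈ ν.toSubmodule, z ≠ 0 → z ∉ B}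

theorem isOpen_avoidingSet {C : Set (EuclideanSpace ℝ (Fin n))} (hC : IsClosed C)
    (hsmul : ∀ t : ℝ, 0 < t → ∀ z ∈ C, t • z ∈ C) : IsOpen (avoidingSet l C) := by
  let S : Set (Grassmannian n l × sphere (0 : EuclideanSpace ℝ (Fin n)) 1) :=
    {p | p.1.toSubmodule.starProjection p.2 = p.2 ∧ (p.2 : EuclideanSpace ℝ (Fin n)) ∈ C}
  have hproj : Continuous fun ν : Grassmannian n l => ν.toSubmodule.starProjection :=
    continuous_induced_dom
  have hS : IsClosed S :=
    (isClosed_eq ((hproj.comp continuous_fst).clm_apply (by fun_prop)) (by fun_prop)).inter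
      (hC.preimage (by fun_prop))
  have hcompl : avoidingSet l C = (Prod.fst '' S)ᶜ := by
    ext ν
    refine ⟨?_, fun h z hz hz₀ hzC => h ?_⟩
    · rintro hν ⟨⟨_, z⟩, ⟨hz, hzC⟩, rfl⟩
      exact hν z (Submodule.starProjection_eq_self_iff.1 hz) (ne_zero_of_mem_unit_sphere z) hzC
    · have hnorm : ‖z‖⁻¹ • z ∈ sphere (0 : EuclideanSpace ℝ (Fin n)) 1 := by
        rw [mem_sphere_zero_iff_norm]
        exact norm_smul_inv_norm hz₀
      exact ⟨(ν, ⟨_, hnorm⟩), ⟨Submodule.starProjection_eq_self_iff.2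
        (ν.toSubmodule.smul_mem _ hz), hsmul _ (inv_pos.2 (norm_pos_iff.2 hz₀)) z hzC⟩, rfl⟩
  rw [hcompl]
  exact (isClosedMap_fst_of_compactSpace S hS).isOpen_compl

theorem exists_mem_closure_of_notMem_interior_avoidingSet
    {B : Set (EuclideanSpace ℝ (Fin n))} (hsmul : ∀ t : ℝ, 0 < t → ∀ z ∈ B, t • z ∈ B)
    {ν : Grassmannian n l} (hν : ν ∉ interior (avoidingSet l B)) :
    ∃ z ∈ ν.toSubmodule, z ≠ 0 ∧ z ∈ closure B := by
  have hopen : IsOpen (avoidingSet l (closure B)) :=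
    isOpen_avoidingSet isClosed_closure fun t ht z hz =>
      map_mem_closure (continuous_const_smul t) hz (hsmul t ht)
  have hsub : avoidingSet l (closure B) ⊆ avoidingSet l B :=
    fun ν h z hz hz₀ hzB => h z hz hz₀ (subset_closure hzB)
  have hν' : ν ∉ avoidingSet l (closure B) := fun h => hν (interior_maximal hsub hopen h)
  simpa [avoidingSet] using hν'

theorem coordInv_notMem_avoidingSet {B : Set (EuclideanSpace ℝ (Fin n))} {K : IndexSet n l}
    {M : Model n l} {c : Fin l → ℝ} (hc : c ≠ 0) (h : WithLp.toLp 2 (stack K M *ᵥ c) ∈ B) :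
    coordInv K M ∉ avoidingSet l B := by
  refine fun hν => hν _ (mem_colSpan.2 ⟨c, rfl⟩) (fun h₀ => hc ?_) h
  apply mulVec_injective_of_det (det_stack_row K M)
  rw [Matrix.mulVec_zero]
  exact congrArg WithLp.ofLp h₀

theorem exists_eventually_coordInv_notMem_avoidingSet {T : Set (Fin n)}
    {B : Set (EuclideanSpace ℝ (Fin n))} (hB : IsDominanceClosed T B) {K : IndexSet n l}
    {M : Model n l} {c : Fin l → ℝ} (hc : c ≠ 0)
    (hmem : WithLp.toLp 2 (stack K M *ᵥ c) ∈ closure B)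
    (hzero : ∀ i ∉ T, (stack K M *ᵥ c) i = 0 → i ∈ K.toFinset) :
    ∃ D : Model n l, ∀ᶠ p in 𝓝[>] (0 : ℝ) ×ˢ 𝓝 D,
      coordInv K (M + p.1 • p.2) ∉ avoidingSet l B := by
  obtain ⟨s, hs₀, hs⟩ := hB.exists_eventually_add_smul_mem hmem
  obtain ⟨D, hD⟩ := exists_stackDeriv_eq K M hc s
  refine ⟨D, ?_⟩
  let σ : Fin l → ℝ := s ∘ K.row
  have hle : 𝓝[>] (0 : ℝ) ×ˢ 𝓝 D ≤ 𝓝 (0, D) :=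
    (prod_mono_left _ nhdsWithin_le_nhds).trans nhds_prod_eq.ge
  have hcont : Continuous fun p : ℝ × Model n l => c + p.1 • σ := by fun_prop
  have hne : ∀ᶠ p in 𝓝[>] (0 : ℝ) ×ˢ 𝓝 D, c + p.1 • σ ≠ 0 :=
    hle (hcont.continuousAt.eventually_ne (by simpa using hc))
  have hderiv : Tendsto (fun p : ℝ × Model n l => stackDeriv K M (c + p.1 • σ) p.2 σ)
      (𝓝[>] (0 : ℝ) ×ˢ 𝓝 D) (𝓝 s) := by
    have h₀ : stackDeriv K M (c + (0 : ℝ) • σ) D σ = s := by rw [zero_smul, add_zero, hD]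
    have h := ((continuous_stackDeriv K M σ).comp (hcont.prodMk continuous_snd)).tendsto (0, D)
    exact (h.mono_left hle).trans (congrArg 𝓝 h₀).le
  filter_upwards [(tendsto_fst.prodMk hderiv).eventually hs, hne] with p hp hcp
  refine coordInv_notMem_avoidingSet hcp ?_
  rw [stack_add_smul_mulVec_add_smul]
  refine hp fun i hi hui => ?_
  obtain ⟨a, rfl⟩ := exists_row_eq (hzero i hi hui)
  exact (stackDeriv_row K M _ _ σ a).trans (hs₀ _ hi hui)

theorem hasMeasureZero_frontier_avoidingSet {T : Set (Fin n)}
    {B : Set (EuclideanSpace ℝ (Fin n))} (hsmul : ∀ t : ℝ, 0 < t → ∀ z ∈ B, t • z ∈ B)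
    (hB : IsDominanceClosed T B) :
    HasMeasureZero (frontier (avoidingSet l B)) := by
  let A (K : IndexSet n l) : Set (Grassmannian n l) :=
    {ν | ν ∈ closure (avoidingSet l B) ∧ ν ∈ chartDomain K ∧ ∃ D : Model n l,
      ∀ᶠ p in 𝓝[>] (0 : ℝ) ×ˢ 𝓝 D, coordInv K (coord K ν + p.1 • p.2) ∉ avoidingSet l B}
  have hA (K : IndexSet n l) : HasMeasureZero (A K) :=
    hasMeasureZero_of_eventually_coordInv_notMem (fun ν hν => hν.1) (fun ν hν => hν.2.1)
      fun ν hν => hν.2.2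
  refine (hasMeasureZero_compl_iInter_chartDomain.union (.iUnion hA)).mono ?_
  rintro ν ⟨hcl, hint⟩
  refine or_iff_not_imp_left.2 fun hgen => Set.mem_iUnion.2 ?_
  have hgen : ∀ K, ν ∈ chartDomain K := Set.mem_iInter.1 (not_not.1 hgen)
  obtain ⟨z, hz, hz₀, hzB⟩ := exists_mem_closure_of_notMem_interior_avoidingSet hsmul hint
  obtain ⟨K, hK⟩ := exists_indexSet_of_forall_mem_chartDomain hgen hz hz₀
  refine ⟨K, hcl, hgen K, ?_⟩
  rw [← coordInv_coord K (hgen K)] at hz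
  obtain ⟨c, rfl⟩ := mem_colSpan.1 hz
  refine exists_eventually_coordInv_notMem_avoidingSet hB ?_ hzB fun i _ => hK i
  rintro rfl
  exact hz₀ (by rw [Matrix.mulVec_zero, WithLp.toLp_zero])

end Grassmannian

open Grassmannian

variable {n : ℕ} {F : ℝ≥0 → ℝ≥0}

/-- The cone generated by the vectors that cost at least as much on `T` as off `T`. Passing to the
generated cone does not change which subspaces contain such vectors, and makes the set stable under
scaling although `F` need not be homogeneous. -/
def costCone (F : ℝ≥0 → ℝ≥0) (T : Finset (Fin n)) : Set (EuclideanSpace ℝ (Fin n)) :=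
  {z | ∃ t : ℝ, 0 < t ∧ cost F Tᶜ (t • z) ≤ cost F T (t • z)}

theorem cost_le_cost (hF : Monotone F) {T : Finset (Fin n)} {z w : EuclideanSpace ℝ (Fin n)}
    (h : ∀ i ∈ T, |z i| ≤ |w i|) : cost F T z ≤ cost F T w :=
  Finset.sum_le_sum fun i hi => hF (by simpa [← NNReal.coe_le_coe] using h i hi)

theorem smul_mem_costCone {T : Finset (Fin n)} {a : ℝ} (ha : 0 < a)
    {z : EuclideanSpace ℝ (Fin n)} (hz : z ∈ costCone F T) : a • z ∈ costCone F T := by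
  obtain ⟨t, ht, h⟩ := hz
  refine ⟨t * a⁻¹, mul_pos ht (inv_pos.2 ha), ?_⟩
  rwa [smul_smul, inv_mul_cancel_right₀ ha.ne']

theorem isDominanceClosed_costCone (hF : Monotone F) (T : Finset (Fin n)) :
    IsDominanceClosed (T : Set (Fin n)) (costCone F T) := by
  rintro z w ⟨t, ht, h⟩ hT hTc
  have hscale {x y : ℝ} (hxy : |x| ≤ |y|) : |t * x| ≤ |t * y| := by
    rw [abs_mul, abs_mul]
    gcongr
  refine ⟨t, ht, ?_⟩
  calc cost F Tᶜ (t • w)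
      ≤ cost F Tᶜ (t • z) :=
        cost_le_cost hF fun i hi => hscale (hTc i (Finset.mem_compl.1 hi))
    _ ≤ cost F T (t • z) := h
    _ ≤ cost F T (t • w) := cost_le_cost hF fun i hi => hscale (hT i hi)

theorem mem_avoidingSet_costCone {l : ℕ} {T : Finset (Fin n)} {ν : Grassmannian n l} :
    ν ∈ avoidingSet l (costCone F T) ↔
      ∀ z ∈ ν.toSubmodule, z ≠ 0 → cost F T z < cost F Tᶜ z := by
  refine ⟨fun h z hz hz₀ => ?_, ?_⟩
  · by_contra! hle
    exact h z hz hz₀ ⟨1, one_pos, by rwa [one_smul]⟩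
  · rintro h z hz hz₀ ⟨t, ht, hle⟩
    exact hle.not_gt (h _ (ν.toSubmodule.smul_mem t hz) (smul_ne_zero ht.ne' hz₀))

theorem exactRecoverySet_eq_iInter (F : ℝ≥0 → ℝ≥0) (n k l : ℕ) : exactRecoverySet F n k l =
    ⋂ T : {T : Finset (Fin n) // T.card ≤ k}, avoidingSet l (costCone F T.1) := by
  ext ν
  simp only [Set.mem_iInter, mem_avoidingSet_costCone, Subtype.forall]
  exact ⟨fun h T hT z hz hz₀ => h z hz hz₀ T hT, fun h z hz hz₀ T hT => h T hT z hz hz₀⟩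

theorem hasMeasureZero_frontier_exactRecoverySet (hF : Monotone F) (n k l : ℕ) :
    HasMeasureZero (frontier (exactRecoverySet F n k l)) := by
  rw [exactRecoverySet_eq_iInter]
  exact (HasMeasureZero.iUnion fun T : {T : Finset (Fin n) // T.card ≤ k} =>
    hasMeasureZero_frontier_avoidingSet (fun _ ht _ => smul_mem_costCone ht)
      (isDominanceClosed_costCone hF T.1)).mono (frontier_iInter_subset _)

end SparseRecovery

theorem theorem4_general {F : ℝ≥0 → ℝ≥0} (hmono : Monotone F) (n k l : ℕ) :
    SparseRecovery.Grassmannian.HasMeasureZero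
        (closure (SparseRecovery.exactRecoverySet F n k l) \
          interior (SparseRecovery.exactRecoverySet F n k l)) ∧
      IsMeagre
        (closure (SparseRecovery.exactRecoverySet F n k l) \
          interior (SparseRecovery.exactRecoverySet F n k l)) := by
  have h := SparseRecovery.hasMeasureZero_frontier_exactRecoverySet hmono n k l
  exact ⟨h, h.isMeagre isClosed_frontier⟩

theorem theorem4 (F : ℝ≥0 → ℝ≥0) (hF : SparseRecovery.IsSparsenessMeasure F)
    (hmono : Monotone F) (n k l : ℕ) :
    SparseRecovery.Grassmannian.HasMeasureZero
        (closure (SparseRecovery.exactRecoverySet F n k l) \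
          interior (SparseRecovery.exactRecoverySet F n k l)) ∧
      IsMeagre
        (closure (SparseRecovery.exactRecoverySet F n k l) \
          interior (SparseRecovery.exactRecoverySet F n k l)) :=
  theorem4_general hmono n k l
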